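/- Let $G$ be a connected finite simple graph with vertex set $\{1,\dots,n\}$ and edge set $E(G)$. For $I\subseteq\{1,\dots,n\}$ let $E(I)$ denote the set of edges of $G$ with exactly one end in $I$, and let $d_G(i)$ denote the degree of the vertex $i$. A sequence $(r_1,\dots,r_n)$ of integers is the score vector of some orientation $D$ of $G$ (that is, each edge of $G$ is given exactly one of its two directions, and $r_i$ is the out-degree of $i$ in $D$ for every $i$) if and only if $$\sum_{i=1}^n r_i=|E(G)|\qquad\text{and}\qquad 2\sum_{i\in I} r_i\le |E(I)|+\sum_{i\in I} d_G(i)$$ for every set $\emptyset\ne I\subsetneq\{1,\dots,n\}$ such that the subgraphs of $G$ induced on $I$ and on $\{1,\dots,n\}\setminus I$ are both connected. In the case of complete graphs one has Landau's theorem: integers $r_1\le r_2\le\dots\le r_n$ are the scores (out-degrees of the vertices $1,\dots,n$) of some tournament, i.e. of some orientation of the complete graph on $\{1,\dots,n\}$, if and only if $\sum_{i=1}^n r_i=\binom n2$ and $\sum_{i=1}^k r_i\ge\binom k2$ for all $1\le k<n$. -/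

import Mathlib

open Finset

/-- `D` is an orientation of the simple graph `G`: every edge of `G` is given exactly one of its
two directions, and `D` has no other arcs (in particular no loops). -/
def Digraph.IsOrientationOf {V : Type*} (D : Digraph V) (G : SimpleGraph V) : Prop :=
  (∀ u v, G.Adj u v ↔ D.Adj u v ∨ D.Adj v u) ∧ ∀ u v, D.Adj u v → ¬ D.Adj v u

open Classical in
/-- The out-degree of `v` in `D`: the number of arcs with tail `v`. -/
noncomputable def Digraph.outDegree {V : Type*} [Fintype V] (D : Digraph V) (v : V) : ℕ :=
  #{w | D.Adj v w}

/-- The integer vector `r` is the score vector of `D`: its entries are the out-degrees of `D`. -/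
def Digraph.IsScoreVector {V : Type*} [Fintype V] (D : Digraph V) (r : V → ℤ) : Prop :=
  ∀ v, r v = D.outDegree v

/-- The set of edges of `G` with exactly one end in `I`. -/
def SimpleGraph.edgeCut {V : Type*} [Fintype V] [DecidableEq V] (G : SimpleGraph V)
    [DecidableRel G.Adj] (I : Finset V) : Finset (Sym2 V) :=
  {e ∈ G.edgeFinset | ∃ u ∈ I, ∃ v ∉ I, e = s(u, v)}

/-!
Giving each edge a tail, with `v` used at most `r v` times, is a Hall problem whose condition says
that every vertex set `I` spans at most `∑ v ∈ I, r v` edges; when the `r v` sum to the number of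
edges, every `v` is then used exactly `r v` times. In terms of the imbalance
`x v = 2 * r v - d(v)`, of total `0`, the condition on `I` and on its complement together read
`|∑ v ∈ I, x v| ≤ |E(I)|`.

This inequality is invariant under complementation, and it passes to unions of disjoint sets
without edges between them. Hence it spreads from the sides of bonds (sets which, like their
complements, induce connected subgraphs) first to the complement of any `J` inducing a connected
subgraph, since the components of `Jᶜ` are sides of bonds, then to `J` itself, and finally to all
sets by way of their components.

In a complete graph `I` spans `(#I).choose 2` edges, so only the sets with the smallest scores
matter.
-/

section InducedComponents

variable {V : Type*} [DecidableEq V] {G : SimpleGraph V}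

/-- `C` is the vertex set of a connected component of the subgraph of `G` induced on `S`. It is
encoded by connectedness and the absence of edges to the rest of `S`, so as to stay within finite
subsets of `V`. -/
structure IsInducedComponent (G : SimpleGraph V) (S C : Finset V) : Prop where
  subset : C ⊆ S
  connected : (G.induce (C : Set V)).Connected
  not_adj : ∀ x ∈ C, ∀ y ∈ S \ C, ¬ G.Adj x y

lemma IsInducedComponent.nonempty {S C : Finset V} (hC : IsInducedComponent G S C) :
    C.Nonempty :=
  Set.nonempty_coe_sort.1 hC.connected.nonempty

lemma IsInducedComponent.of_sdiff {S C D : Finset V} (hC : IsInducedComponent G S C)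
    (hD : IsInducedComponent G (S \ C) D) : IsInducedComponent G S D where
  subset := hD.subset.trans sdiff_subset
  connected := hD.connected
  not_adj x hx y hy hxy := by
    by_cases hyC : y ∈ C
    · exact hC.not_adj y hyC x (hD.subset hx) hxy.symm
    · exact hD.not_adj x hx y (by grind) hxy

lemma exists_isInducedComponent {S : Finset V} {v : V} (hv : v ∈ S) :
    ∃ C, IsInducedComponent G S C ∧ v ∈ C := by
  classical
  let F : Finset (Finset V) := {C ∈ S.powerset | v ∈ C ∧ (G.induce (C : Set V)).Connected}
  have hsingleton : (G.induce (({v} : Finset V) : Set V)).Connected := by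
    rw [coe_singleton, SimpleGraph.induce_singleton_eq_top]
    exact SimpleGraph.connected_top
  have hF : F.Nonempty := ⟨{v}, by simpa [F, hv] using hsingleton⟩
  obtain ⟨C, hC⟩ := F.exists_maximal hF
  obtain ⟨hCS, hvC, hconn⟩ : C ⊆ S ∧ v ∈ C ∧ (G.induce (C : Set V)).Connected := by
    simpa [F] using hC.prop
  refine ⟨C, ⟨hCS, hconn, fun x hx y hy hxy ↦ ?_⟩, hvC⟩
  obtain ⟨hyS, hyC⟩ := mem_sdiff.1 hy
  have hinsert : (G.induce (insert y C : Finset V)).Connected := by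
    rw [coe_insert, Set.insert_eq]
    refine SimpleGraph.connected_induce_union (v := y) (w := x) ?_ hconn.preconnected
      rfl hx hxy.symm
    rw [SimpleGraph.induce_singleton_eq_top]
    exact SimpleGraph.connected_top.preconnected
  have hle := hC.le_of_ge (y := insert y C)
    (mem_filter.2 ⟨mem_powerset.2 (insert_subset hyS hCS), mem_insert_of_mem hvC, hinsert⟩)
    (subset_insert y C)
  exact hyC (hle (mem_insert_self y C))

lemma inducedComponent_induction {P : Finset V → Prop} (S : Finset V) (empty : P ∅)
    (union : ∀ A B, Disjoint A B → (∀ x ∈ A, ∀ y ∈ B, ¬ G.Adj x y) → P A → P B → P (A ∪ B))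
    (component : ∀ C, IsInducedComponent G S C → P C) : P S := by
  induction S using Finset.strongInduction with
  | H S ih =>
    obtain rfl | ⟨v, hv⟩ := S.eq_empty_or_nonempty
    · exact empty
    obtain ⟨C, hC, -⟩ := exists_isInducedComponent (G := G) hv
    have hrest : P (S \ C) := ih _ (sdiff_ssubset hC.subset hC.nonempty)
      fun D hD ↦ component D (hC.of_sdiff hD)
    rw [← union_sdiff_of_subset hC.subset]
    exact union _ _ disjoint_sdiff hC.not_adj (component C hC) hrest

lemma IsInducedComponent.connected_compl [Fintype V] (hG : G.Preconnected) {I C : Finset V}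
    (hI : (G.induce (I : Set V)).Connected) (hC : IsInducedComponent G Iᶜ C) :
    (G.induce (C : Set V)ᶜ).Connected := by
  rw [← coe_compl]
  obtain ⟨u, hu⟩ := Set.nonempty_coe_sort.1 hI.nonempty
  have hIC : I ⊆ Cᶜ := subset_compl_comm.1 hC.subset
  refine SimpleGraph.induce_connected_of_patches u (hIC hu) fun {w} hw ↦ ?_
  obtain ⟨K, hK, hwK⟩ := exists_isInducedComponent (G := G) (mem_coe.1 hw)
  -- An edge leaving `K` ends in `C`, and the only neighbours of `C` outside `C` lie in `I`.
  have hKI : ((K : Set V) ∩ I).Nonempty := by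
    obtain ⟨c, hc⟩ := hC.nonempty
    obtain ⟨p⟩ := hG w c
    obtain ⟨d, -, hdK, hdK'⟩ := p.exists_boundary_dart (K : Set V) hwK
      fun hcK ↦ mem_compl.1 (hK.subset hcK) hc
    rw [mem_coe] at hdK hdK'
    have hfst : d.fst ∉ C := mem_compl.1 (hK.subset hdK)
    have hsnd : d.snd ∈ C := by
      by_contra h
      exact hK.not_adj _ hdK _ (mem_sdiff.2 ⟨mem_compl.2 h, hdK'⟩) d.adj
    refine ⟨d.fst, hdK, ?_⟩
    by_contra h
    exact hC.not_adj _ hsnd _ (mem_sdiff.2 ⟨mem_compl.2 h, hfst⟩) d.adj.symm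
  have hconn : (G.induce ((K : Set V) ∪ I)).Connected :=
    SimpleGraph.induce_union_connected hK.connected.preconnected hI.preconnected hKI
  refine ⟨K ∪ I, ?_, .inr hu, .inl hwK, hconn.preconnected _ _⟩
  exact_mod_cast union_subset hK.subset hIC

lemma bond_induction [Fintype V] (hG : G.Preconnected) {P : Finset V → Prop} (empty : P ∅)
    (union : ∀ A B, Disjoint A B → (∀ x ∈ A, ∀ y ∈ B, ¬ G.Adj x y) → P A → P B → P (A ∪ B))
    (compl : ∀ I, P I → P Iᶜ)
    (bond : ∀ I : Finset V, (G.induce (I : Set V)).Connected →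
      (G.induce (I : Set V)ᶜ).Connected → P I)
    (I : Finset V) : P I := by
  refine inducedComponent_induction I empty union fun J hJ ↦ ?_
  have hJc : P Jᶜ := inducedComponent_induction Jᶜ empty union fun C hC ↦
    bond C hC.connected (hC.connected_compl hG hJ.connected)
  simpa using compl _ hJc

end InducedComponents

section Edges

variable {V : Type*} [Fintype V] [DecidableEq V] (G : SimpleGraph V) [DecidableRel G.Adj]
  (I : Finset V)

/-- The edges of `G` with both ends in `I`, that is, the edges of the subgraph induced on `I`. -/
def edgesWithin : Finset (Sym2 V) := {e ∈ G.edgeFinset | e ∈ I.sym2}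

variable {G I}

lemma edgesWithin_subset : edgesWithin G I ⊆ G.edgeFinset := filter_subset _ _

lemma mk_mem_edgesWithin {u v : V} :
    s(u, v) ∈ edgesWithin G I ↔ G.Adj u v ∧ u ∈ I ∧ v ∈ I := by
  simp [edgesWithin]

lemma mk_mem_edgeCut {u v : V} :
    s(u, v) ∈ G.edgeCut I ↔ G.Adj u v ∧ (u ∈ I ∧ v ∉ I ∨ v ∈ I ∧ u ∉ I) := by
  simp only [SimpleGraph.edgeCut, mem_filter, SimpleGraph.mem_edgeFinset,
    SimpleGraph.mem_edgeSet, Sym2.eq_iff]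
  grind

variable (G I)

lemma edgeCut_compl : G.edgeCut Iᶜ = G.edgeCut I := by
  ext e
  induction e with | _ u v
  simp only [mk_mem_edgeCut, mem_compl]
  tauto

lemma two_mul_card_edgesWithin_add_card_edgeCut :
    2 * #(edgesWithin G I) + #(G.edgeCut I) = ∑ v ∈ I, G.degree v := by
  have hends : ∀ e ∈ G.edgeFinset, #{v ∈ I | v ∈ e} =
      2 * (if e ∈ edgesWithin G I then 1 else 0) + if e ∈ G.edgeCut I then 1 else 0 := by
    intro e he
    induction e with | _ u v
    rw [SimpleGraph.mem_edgeFinset, SimpleGraph.mem_edgeSet] at he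
    have hpair : ({w ∈ I | w ∈ s(u, v)} : Finset V) = {w ∈ ({u, v} : Finset V) | w ∈ I} := by
      ext w
      simp [and_comm]
    rw [hpair, card_filter, sum_pair he.ne]
    simp only [mk_mem_edgesWithin, mk_mem_edgeCut, he, true_and]
    split_ifs <;> grind
  have hcut : G.edgeCut I ⊆ G.edgeFinset := filter_subset _ _
  calc 2 * #(edgesWithin G I) + #(G.edgeCut I)
      = ∑ e ∈ G.edgeFinset, #{v ∈ I | v ∈ e} := by
        rw [sum_congr rfl hends, sum_add_distrib, ← mul_sum, ← card_filter, ← card_filter,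
          filter_mem_eq_inter, filter_mem_eq_inter, inter_eq_right.2 edgesWithin_subset,
          inter_eq_right.2 hcut]
    _ = ∑ v ∈ I, #{e ∈ G.edgeFinset | v ∈ e} :=
        (sum_card_bipartiteAbove_eq_sum_card_bipartiteBelow (s := I) (· ∈ ·)).symm
    _ = ∑ v ∈ I, G.degree v := by
        simp only [← SimpleGraph.incidenceFinset_eq_filter,
          SimpleGraph.card_incidenceFinset_eq_degree]

lemma card_edgesWithin_top : #(edgesWithin (⊤ : SimpleGraph V) I) = (#I).choose 2 := by
  rw [← Sym2.card_image_offDiag]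
  congr 1
  ext e
  induction e with | _ u v
  simp only [mk_mem_edgesWithin, SimpleGraph.top_adj, mem_image, mem_offDiag, Prod.exists]
  grind

variable {G}

lemma card_edgeCut_union {A B : Finset V} (hAB : Disjoint A B)
    (h : ∀ x ∈ A, ∀ y ∈ B, ¬ G.Adj x y) :
    #(G.edgeCut (A ∪ B)) = #(G.edgeCut A) + #(G.edgeCut B) := by
  rw [Finset.disjoint_left] at hAB
  rw [← card_union_of_disjoint]
  · congr 1
    ext e
    induction e with | _ u v
    simp only [mem_union, mk_mem_edgeCut]
    grind [G.adj_comm u v]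
  · rw [Finset.disjoint_left]
    intro e
    induction e with | _ u v
    simp only [mk_mem_edgeCut]
    grind [G.adj_comm u v]

lemma abs_sum_le_card_edgeCut {R : Type*} [Ring R] [LinearOrder R] [IsOrderedRing R]
    (hG : G.Preconnected) {x : V → R} (hx : ∑ v, x v = 0)
    (h : ∀ I : Finset V, (G.induce (I : Set V)).Connected →
      (G.induce (I : Set V)ᶜ).Connected → ∑ v ∈ I, x v ≤ #(G.edgeCut I)) :
    |∑ v ∈ I, x v| ≤ #(G.edgeCut I) := by
  have hcompl (I : Finset V) : ∑ v ∈ Iᶜ, x v = -∑ v ∈ I, x v :=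
    eq_neg_of_add_eq_zero_right ((sum_add_sum_compl I x).trans hx)
  refine bond_induction (P := fun I ↦ |∑ v ∈ I, x v| ≤ #(G.edgeCut I)) hG ?_ ?_ ?_ ?_ I
  · simp
  · intro A B hAB hadj hA hB
    rw [sum_union hAB, card_edgeCut_union hAB hadj, Nat.cast_add]
    exact (abs_add_le _ _).trans (add_le_add hA hB)
  · intro I hI
    rwa [hcompl, abs_neg, edgeCut_compl]
  · intro I hI hIc
    have hle : -∑ v ∈ I, x v ≤ #(G.edgeCut I) := by
      rw [← hcompl, ← edgeCut_compl]
      exact h Iᶜ (by rwa [coe_compl]) (by rwa [coe_compl, compl_compl])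
    exact abs_le'.2 ⟨h I hI hIc, hle⟩

end Edges

lemma exists_mem_card_fiber_le {ι α : Type*} [Fintype ι] [DecidableEq α]
    {t : ι → Finset α} {c : α → ℕ} (h : ∀ s : Finset ι, #s ≤ ∑ a ∈ s.biUnion t, c a) :
    ∃ f : ι → α, (∀ i, f i ∈ t i) ∧ ∀ a, #{i | f i = a} ≤ c a := by
  -- Hall's theorem, with every `a` replaced by `c a` copies of itself.
  let copies (s : Finset α) : Finset (Σ _ : α, ℕ) := s.sigma fun a ↦ range (c a)
  have hhall (s : Finset ι) : #s ≤ #(s.biUnion fun i ↦ copies (t i)) := by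
    have hunion : s.biUnion (fun i ↦ copies (t i)) = copies (s.biUnion t) := by
      ext
      simp only [copies, mem_biUnion, mem_sigma]
      grind
    simpa [hunion, copies] using h s
  obtain ⟨g, hinj, hg⟩ := (all_card_le_biUnion_card_iff_exists_injective _).1 hhall
  simp only [copies, mem_sigma, mem_range] at hg
  refine ⟨fun i ↦ (g i).1, fun i ↦ (hg i).1, fun a ↦ ?_⟩
  rw [← card_range (c a)]
  refine card_le_card_of_injOn (fun i ↦ (g i).2) (fun i hi ↦ ?_) fun i hi j hj hij ↦ ?_
  · obtain rfl : (g i).1 = a := by simpa using hi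
    simpa using (hg i).2
  · have hi : (g i).1 = a := by simpa using hi
    have hj : (g j).1 = a := by simpa using hj
    exact hinj (Sigma.ext (hi.trans hj.symm) (heq_of_eq hij))

open Classical in
lemma sum_outDegree_eq_ncard {V : Type*} [Fintype V] {D : Digraph V}
    (hD : ∀ u v, D.Adj u v → ¬ D.Adj v u) (I : Finset V) :
    ∑ v ∈ I, D.outDegree v = {e : Sym2 V | ∃ u ∈ I, ∃ v, D.Adj u v ∧ s(u, v) = e}.ncard := by
  let arcs : Finset (Σ _ : V, V) := I.sigma fun v ↦ {w | D.Adj v w}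
  have hinj : Set.InjOn (fun a : Σ _ : V, V ↦ s(a.1, a.2)) arcs := by
    rintro ⟨u, v⟩ h ⟨u', v'⟩ h' heq
    have huv : D.Adj u v := by simpa using (mem_sigma.1 h).2
    have huv' : D.Adj u' v' := by simpa using (mem_sigma.1 h').2
    obtain ⟨rfl, rfl⟩ | ⟨rfl, rfl⟩ := Sym2.eq_iff.1 heq
    · rfl
    · exact absurd huv' (hD _ _ huv)
  calc ∑ v ∈ I, D.outDegree v
      = #arcs := by simp only [arcs, card_sigma, Digraph.outDegree]
    _ = #(arcs.image fun a ↦ s(a.1, a.2)) := (card_image_of_injOn hinj).symm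
    _ = {e : Sym2 V | ∃ u ∈ I, ∃ v, D.Adj u v ∧ s(u, v) = e}.ncard := by
        rw [← Set.ncard_coe_finset]
        congr 1
        ext e
        simp [arcs, and_assoc]

section Orientations

variable {V : Type*} {G : SimpleGraph V}

/-- The orientation of `G` in which the edge `e` has tail `t e`; this makes sense when `t e` is an
end of `e`. -/
def digraphOfTail (t : G.edgeSet → V) : Digraph V where
  Adj u v := ∃ h : G.Adj u v, t ⟨s(u, v), h⟩ = u

lemma isOrientationOf_digraphOfTail {t : G.edgeSet → V} (ht : ∀ e, t e ∈ e.1) :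
    (digraphOfTail t).IsOrientationOf G := by
  have hswap {u v : V} (h : G.Adj u v) :
      (⟨s(u, v), h⟩ : G.edgeSet) = ⟨s(v, u), h.symm⟩ := Subtype.ext Sym2.eq_swap
  refine ⟨fun u v ↦ ⟨fun h ↦ ?_, ?_⟩, ?_⟩
  · obtain htail | htail := Sym2.mem_iff.1 (ht ⟨s(u, v), h⟩)
    · exact .inl ⟨h, htail⟩
    · exact .inr ⟨h.symm, hswap h ▸ htail⟩
  · rintro (⟨h, -⟩ | ⟨h, -⟩)
    exacts [h, h.symm]
  · rintro u v ⟨h, hu⟩ ⟨h', hv⟩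
    rw [hswap h', hu] at hv
    exact h.ne hv

variable [Fintype V] [DecidableRel G.Adj]

lemma outDegree_digraphOfTail_le [DecidableEq V] (t : G.edgeSet → V) (v : V) :
    (digraphOfTail t).outDegree v ≤ #{e | t e = v} := by
  classical
  rw [Digraph.outDegree, ← card_map (Function.Embedding.subtype _),
    ← card_image_of_injective _ (fun w w' ↦ Sym2.congr_right.1 : Function.Injective (s(v, ·)))]
  refine card_le_card fun e he ↦ ?_
  obtain ⟨w, ⟨h, htail⟩, rfl⟩ : ∃ w, (digraphOfTail t).Adj v w ∧ s(v, w) = e := by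
    simpa using he
  exact mem_map.2 ⟨⟨s(v, w), h⟩, by simpa using htail, rfl⟩

lemma sum_outDegree_eq_card_edgeFinset {D : Digraph V} (hD : D.IsOrientationOf G) :
    ∑ v, D.outDegree v = #G.edgeFinset := by
  rw [sum_outDegree_eq_ncard hD.2, ← Set.ncard_coe_finset, SimpleGraph.coe_edgeFinset]
  congr 1
  ext e
  induction e with | _ u v
  simp only [mem_univ, true_and, Set.mem_ofPred_eq, SimpleGraph.mem_edgeSet, hD.1 u v,
    Sym2.eq_iff]
  grind

lemma card_edgesWithin_le_sum_outDegree [DecidableEq V] {D : Digraph V} (hD : D.IsOrientationOf G)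
    (I : Finset V) : #(edgesWithin G I) ≤ ∑ v ∈ I, D.outDegree v := by
  rw [sum_outDegree_eq_ncard hD.2, ← Set.ncard_coe_finset]
  refine Set.ncard_le_ncard (fun e he ↦ ?_) (Set.toFinite _)
  induction e with | _ u v
  obtain ⟨huv, hu, hv⟩ := mk_mem_edgesWithin.1 (mem_coe.1 he)
  obtain h | h := (hD.1 u v).1 huv
  · exact ⟨u, hu, v, h, rfl⟩
  · exact ⟨v, hv, u, h, Sym2.eq_swap⟩

lemma exists_isOrientationOf_outDegree_le [DecidableEq V] {c : V → ℕ}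
    (h : ∀ I, #(edgesWithin G I) ≤ ∑ v ∈ I, c v) :
    ∃ D : Digraph V, D.IsOrientationOf G ∧ ∀ v, D.outDegree v ≤ c v := by
  have hhall (s : Finset G.edgeSet) : #s ≤ ∑ v ∈ s.biUnion fun e ↦ e.1.toFinset, c v := by
    refine le_trans ?_ (h _)
    rw [← card_map (Function.Embedding.subtype _)]
    refine card_le_card fun e he ↦ ?_
    obtain ⟨e, hes, rfl⟩ := mem_map.1 he
    refine mem_filter.2 ⟨SimpleGraph.mem_edgeFinset.2 e.2, mem_sym2_iff.2 fun v hv ↦ ?_⟩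
    exact mem_biUnion.2 ⟨e, hes, Sym2.mem_toFinset.2 hv⟩
  obtain ⟨t, ht, hcard⟩ := exists_mem_card_fiber_le hhall
  exact ⟨digraphOfTail t, isOrientationOf_digraphOfTail fun e ↦ Sym2.mem_toFinset.1 (ht e),
    fun v ↦ (outDegree_digraphOfTail_le t v).trans (hcard v)⟩

variable (G) in
/-- The out-degree minus the in-degree of the vertices, in an orientation of `G` with score
vector `r`. -/
def imbalance (r : V → ℤ) (v : V) : ℤ := 2 * r v - G.degree v

lemma sum_imbalance (r : V → ℤ) (I : Finset V) :
    ∑ v ∈ I, imbalance G r v = 2 * ∑ v ∈ I, r v - ∑ v ∈ I, (G.degree v : ℤ) := by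
  simp only [imbalance, sum_sub_distrib, mul_sum]

lemma sum_univ_imbalance {r : V → ℤ} (hr : ∑ v, r v = #G.edgeFinset) :
    ∑ v, imbalance G r v = 0 := by
  rw [sum_imbalance, hr, sub_eq_zero]
  exact_mod_cast G.sum_degrees_eq_twice_card_edges.symm

variable [DecidableEq V]

theorem exists_isScoreVector_iff_card_edgesWithin_le {r : V → ℤ} :
    (∃ D : Digraph V, D.IsOrientationOf G ∧ D.IsScoreVector r) ↔
      ∑ v, r v = #G.edgeFinset ∧ ∀ I, (#(edgesWithin G I) : ℤ) ≤ ∑ v ∈ I, r v := by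
  constructor
  · rintro ⟨D, hD, hr⟩
    simp only [show ∀ v, r v = D.outDegree v from hr]
    exact ⟨mod_cast sum_outDegree_eq_card_edgeFinset hD,
      fun I ↦ mod_cast card_edgesWithin_le_sum_outDegree hD I⟩
  · rintro ⟨hsum, h⟩
    have hr (v : V) : 0 ≤ r v := by simpa using (Nat.cast_nonneg _).trans (h {v})
    lift r to V → ℕ using hr
    beta_reduce at hsum h
    have hle (I : Finset V) : #(edgesWithin G I) ≤ ∑ v ∈ I, r v := mod_cast h I
    obtain ⟨D, hD, hDr⟩ := exists_isOrientationOf_outDegree_le hle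
    have htotal : ∑ v, D.outDegree v = ∑ v, r v :=
      (sum_outDegree_eq_card_edgeFinset hD).trans (mod_cast hsum.symm)
    have heq := (sum_eq_sum_iff_of_le fun v _ ↦ hDr v).1 htotal
    exact ⟨D, hD, fun v ↦ congrArg Nat.cast (heq v (mem_univ v)).symm⟩

lemma card_edgesWithin_le_sum_iff {r : V → ℤ} {I : Finset V} :
    (#(edgesWithin G I) : ℤ) ≤ ∑ v ∈ I, r v ↔ -#(G.edgeCut I) ≤ ∑ v ∈ I, imbalance G r v := by
  have hdegree : 2 * (#(edgesWithin G I) : ℤ) + #(G.edgeCut I) = ∑ v ∈ I, (G.degree v : ℤ) :=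
    mod_cast two_mul_card_edgesWithin_add_card_edgeCut G I
  rw [sum_imbalance]
  lia

theorem exists_isScoreVector_iff_abs_sum_imbalance_le {r : V → ℤ} :
    (∃ D : Digraph V, D.IsOrientationOf G ∧ D.IsScoreVector r) ↔
      ∑ v, r v = #G.edgeFinset ∧ ∀ I, |∑ v ∈ I, imbalance G r v| ≤ #(G.edgeCut I) := by
  simp only [exists_isScoreVector_iff_card_edgesWithin_le, card_edgesWithin_le_sum_iff, abs_le]
  refine and_congr_right fun hr ↦ ⟨fun h I ↦ ⟨h I, ?_⟩, fun h I ↦ (h I).1⟩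
  have hcompl := (sum_add_sum_compl I _).trans (sum_univ_imbalance hr)
  have hIc := h Iᶜ
  rw [edgeCut_compl] at hIc
  lia

theorem exists_isScoreVector_iff_of_preconnected (hG : G.Preconnected) {r : V → ℤ} :
    (∃ D : Digraph V, D.IsOrientationOf G ∧ D.IsScoreVector r) ↔
      ∑ v, r v = #G.edgeFinset ∧ ∀ I : Finset V, (G.induce (I : Set V)).Connected →
        (G.induce (I : Set V)ᶜ).Connected →
        ∑ v ∈ I, imbalance G r v ≤ #(G.edgeCut I) := by
  rw [exists_isScoreVector_iff_abs_sum_imbalance_le]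
  exact and_congr_right fun hr ↦ ⟨fun h I _ _ ↦ (le_abs_self _).trans (h I),
    fun h I ↦ abs_sum_le_card_edgeCut I hG (sum_univ_imbalance hr) h⟩

end Orientations

section Tournaments

lemma sum_filter_val_lt_card_le_sum {M : Type*} [AddCommMonoid M] [PartialOrder M]
    [IsOrderedCancelAddMonoid M] {n : ℕ} {r : Fin n → M} (hr : Monotone r) (I : Finset (Fin n)) :
    ∑ i : Fin n with i.val < #I, r i ≤ ∑ i ∈ I, r i := by
  have hI : #I ≤ n := by simpa using card_le_univ I
  obtain heq | hlt := hI.eq_or_lt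
  · obtain rfl : I = univ := by rwa [← card_eq_iff_eq_univ, Fintype.card_fin]
    simp
  set P : Finset (Fin n) := {i | i.val < #I} with hP
  have hcard : #(P \ I) = #(I \ P) :=
    card_sdiff_comm (by rw [hP, Fin.card_filter_val_lt, min_eq_right hI])
  let m : Fin n := ⟨#I, hlt⟩
  rw [← sum_sdiff_le_sum_sdiff]
  calc ∑ i ∈ P \ I, r i
      ≤ #(P \ I) • r m := sum_le_card_nsmul _ _ _ fun i hi ↦
        hr (Fin.le_def.2 (mem_filter.1 (mem_sdiff.1 hi).1).2.le)
    _ = #(I \ P) • r m := by rw [hcard]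
    _ ≤ ∑ i ∈ I \ P, r i := card_nsmul_le_sum _ _ _ fun i hi ↦
        hr (Fin.le_def.2 (by simpa [hP, m] using (mem_sdiff.1 hi).2))

theorem exists_isScoreVector_top_iff_of_monotone {V : Type*} [Fintype V] {n : ℕ} (e : Fin n ≃ V)
    {r : V → ℤ} (hr : Monotone (r ∘ e)) :
    (∃ D : Digraph V, D.IsOrientationOf (⊤ : SimpleGraph V) ∧ D.IsScoreVector r) ↔
      ∑ v, r v = n.choose 2 ∧
        ∀ k : ℕ, 1 ≤ k → k < n → (k.choose 2 : ℤ) ≤ ∑ i : Fin n with i.val < k, r (e i) := by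
  classical
  have hn : Fintype.card V = n := by simpa using (Fintype.card_congr e).symm
  rw [exists_isScoreVector_iff_card_edgesWithin_le,
    SimpleGraph.card_edgeFinset_top_eq_card_choose_two, hn]
  simp only [card_edgesWithin_top]
  refine and_congr_right fun hsum ↦ ⟨fun h k _ hk ↦ ?_, fun h I ↦ ?_⟩
  · simpa [Fin.card_filter_val_lt, hk.le] using
      h (({i | i.val < k} : Finset (Fin n)).map e.toEmbedding)
  · have hprefix : ∑ i : Fin n with i.val < #I, r (e i) ≤ ∑ v ∈ I, r v := by
      simpa using sum_filter_val_lt_card_le_sum hr (I.map e.symm.toEmbedding)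
    obtain hzero | hpos := Nat.eq_zero_or_pos #I
    · simp [card_eq_zero.1 hzero]
    obtain hlt | hge := lt_or_ge #I n
    · exact (h _ hpos hlt).trans hprefix
    · obtain rfl : I = univ := by
        rw [← card_eq_iff_eq_univ]
        exact le_antisymm (card_le_univ I) (hn.trans_le hge)
      rw [hsum, card_univ, hn]

end Tournaments

theorem corollary4p12_general {V : Type*} [Fintype V] [DecidableEq V] :
    (∀ (G : SimpleGraph V) [DecidableRel G.Adj], G.Preconnected → ∀ r : V → ℤ,
      (∃ D : Digraph V, D.IsOrientationOf G ∧ D.IsScoreVector r) ↔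
        (∑ v, r v = (#G.edgeFinset : ℤ) ∧
          ∀ I : Finset V, I.Nonempty → I ≠ univ →
            (G.induce (I : Set V)).Connected →
            (G.induce ((I : Set V)ᶜ)).Connected →
            2 * ∑ v ∈ I, r v ≤ (#(G.edgeCut I) : ℤ) + ∑ v ∈ I, (G.degree v : ℤ))) ∧
    (∀ (n : ℕ) (e : Fin n ≃ V) (r : V → ℤ), Monotone (r ∘ e) →
      ((∃ D : Digraph V, D.IsOrientationOf (⊤ : SimpleGraph V) ∧ D.IsScoreVector r) ↔
        (∑ v, r v = (n.choose 2 : ℤ) ∧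
          ∀ k : ℕ, 1 ≤ k → k < n →
            (k.choose 2 : ℤ) ≤ ∑ i : Fin n with i.val < k, r (e i)))) := by
  refine ⟨fun G _ hG r ↦ ?_, fun _ e _ ↦ exists_isScoreVector_top_iff_of_monotone e⟩
  simp only [exists_isScoreVector_iff_of_preconnected hG, sum_imbalance, sub_le_iff_le_add]
  refine and_congr_right fun _ ↦ ⟨fun h I _ _ ↦ h I, fun h I hI hIc ↦ h I ?_ ?_ hI hIc⟩
  · exact Set.nonempty_coe_sort.1 hI.nonempty
  · rintro rfl
    simpa using hIc.nonempty

theorem corollary4p12 (n : ℕ) :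
    (∀ (G : SimpleGraph (Fin n)) [DecidableRel G.Adj], G.Connected → ∀ r : Fin n → ℤ,
      (∃ D : Digraph (Fin n), D.IsOrientationOf G ∧ D.IsScoreVector r) ↔
        (∑ i, r i = (#G.edgeFinset : ℤ) ∧
          ∀ I : Finset (Fin n), I.Nonempty → I ≠ univ →
            (G.induce (I : Set (Fin n))).Connected →
            (G.induce ((I : Set (Fin n))ᶜ)).Connected →
            2 * ∑ i ∈ I, r i ≤ (#(G.edgeCut I) : ℤ) + ∑ i ∈ I, (G.degree i : ℤ))) ∧
    (∀ r : Fin n → ℤ, Monotone r →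
      ((∃ D : Digraph (Fin n), D.IsOrientationOf (⊤ : SimpleGraph (Fin n)) ∧ D.IsScoreVector r) ↔
        (∑ i, r i = (n.choose 2 : ℤ) ∧
          ∀ k : ℕ, 1 ≤ k → k < n →
            (k.choose 2 : ℤ) ≤ ∑ i : Fin n with i.val < k, r i))) :=
  ⟨fun G _ hG ↦ corollary4p12_general.1 G hG.preconnected,
    corollary4p12_general.2 n (Equiv.refl _)⟩
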